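/- **Setting.** Let $G=\mathbb Z_{12}\times\mathbb Z_6$, written multiplicatively with generators $x,y$ ($x^{12}=y^6=1$), let $A=x^3+y+y^2$, $B=y^3+x+x^2$, viewed as $72\times72$ matrices over $\mathbb F_2$. The gross code is the $[[144,12,12]]$ CSS code with $H_X=[A\mid B]$ and $H_Z=[B^{\mathsf T}\mid A^{\mathsf T}]$; its rows are its $72$ $X$ checks and $72$ $Z$ checks, all of weight six, and $G$ acts by translations on checks and data qubits. A *syndrome extraction circuit* (SEC) measures each check with its own ancilla qubit, the same one in each round: for an $X$ check the ancilla is prepared in $|+\rangle$, CNOTs are applied from the ancilla to each data qubit in the support of the check, and the ancilla is measured in the $X$ basis; for a $Z$ check the ancilla is prepared in $|0\rangle$, CNOTs are applied from each data qubit in the support to the ancilla, and the ancilla is measured in the $Z$ basis. The SEC is specified by the time steps of these operations within a round; each operation takes one time step and no qubit takes part in two operations at the same time. Rounds may be staggered (overlap in time), but on every qubit the operations of one round precede those of the next. The SEC is *non-interleaved* if, within a round, either every $X$-type CNOT precedes every $Z$-type CNOT on the same data qubit, or every $Z$-type CNOT precedes every $X$-type CNOT on the same data qubit. It is *uniformly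 tiled* if all $X$ checks use the same local CNOT ordering, i.e. the order of the six CNOTs of any $X$ check is carried by each translation to the order of the six CNOTs of the translated $X$ check (no condition is put on the $Z$ checks). An $X$-basis ($Z$-basis) memory experiment with $m$ rounds prepares all data qubits in $|+\rangle$ ($|0\rangle$), runs $m$ rounds of the SEC, and measures all data qubits in the $X$ ($Z$) basis. The error mechanisms are: a non-identity one-qubit Pauli on an idling qubit during a time step; a non-identity two-qubit Pauli after a CNOT; a preparation of the orthogonal state; a flip of a measurement outcome. (Preparation and final measurement of the data qubits may be taken as noisy or as perfect.) The detectors are the parities of the outcomes of a check in consecutive rounds and, for the checks of the type of the experiment, also the outcome in the first round and the parity of the outcome in the last round with the value of the check computed from the final data measurement. The logical observables are the logical operators of the type of the experiment, read off from the final data measurement. Let $d^X_{\mathrm{circ}}$ (resp. $d^Z_{\mathrm{circ}}$) be the minimum number of error mechanisms in the $X$-basis (resp. $Z$-basis) experiment that together flip no detector but flip at least one logical observable, and let the circuit distance be $d_{\mathrm{circ}}=\min(d^X_{\mathrm{circ}},d^Z_{\mathrm{circ}})$. **Proposition (Uniformly-tiled gross circuits).** For every uniformly tiled non-interleaved SEC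 for the gross code, every number $m\ge1$ of rounds, and either convention for the noise of the data preparation and final data measurement, $$d_{\mathrm{circ}}\le 10 .$$ -/

import Mathlib

/-! ### Noisy circuits of preparations, measurements and CNOT gates -/

/-- The two bases for preparation and measurement: `|+⟩, |-⟩` for `X` and `|0⟩, |1⟩` for `Z`. -/
inductive Basis where
  | X
  | Z
  deriving DecidableEq

/-- A one-qubit Pauli operator modulo phases: `(x, z)` stands for `X ^ x * Z ^ z`. -/
abbrev Pauli : Type := ZMod 2 × ZMod 2

/-- The Pauli operator that exchanges the two states of a basis. -/
def Basis.flip : Basis → Pauli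
  | .X => (0, 1)
  | .Z => (1, 0)

/-- `1` when the Pauli operator `P` flips the outcome of a measurement in the basis `b`, else `0`. -/
def Basis.detects (b : Basis) (P : Pauli) : ZMod 2 :=
  match b with
  | .X => P.2
  | .Z => P.1

/-- The circuit operations other than idling. -/
inductive Gate (Q : Type) where
  | prep (b : Basis) (q : Q)
  | meas (b : Basis) (q : Q)
  | cnot (control target : Q)
  deriving DecidableEq

/-- The gate `g` acts on the qubit `q`. -/
def Gate.ActsOn {Q : Type} (g : Gate Q) (q : Q) : Prop :=
  match g with
  | .prep _ p => p = q
  | .meas _ p => p = q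
  | .cnot c t => c = q ∨ t = q

/-- The change that a gate makes to a Pauli frame `F`. A preparation erases the Pauli operator on
its qubit; a CNOT copies `X` from control to target and `Z` from target to control. -/
def Gate.kick {Q : Type} [DecidableEq Q] (g : Gate Q) (F : Q → Pauli) (q : Q) : Pauli :=
  match g with
  | .prep _ p => if q = p then - F q else 0
  | .meas _ _ => 0
  | .cnot c t => (if q = t then (F c).1 else 0, if q = c then (F t).2 else 0)

/-- A circuit: a finite set of gates, each with its time step. Every gate takes one time step. -/
abbrev Circuit (Q : Type) : Type := Finset (ℕ × Gate Q)

/-- Single error mechanisms of circuit noise. -/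
inductive Fault (Q : Type) where
  | prepFlip (t : ℕ) (b : Basis) (q : Q)
  | measFlip (t : ℕ) (b : Basis) (q : Q)
  | cnotPauli (t : ℕ) (control target : Q) (P P' : Pauli)
  | idlePauli (t : ℕ) (q : Q) (P : Pauli)

/-- The error mechanisms of a circuit: a preparation may prepare the wrong state of its basis, the
outcome of a measurement may be flipped, a CNOT may be followed by any non-identity two-qubit Pauli
operator, and a qubit that idles during a time step (between the start and the end of the circuit)
may undergo any non-identity one-qubit Pauli operator. -/
def Fault.OccursIn {Q : Type} (f : Fault Q) (C : Circuit Q) : Prop :=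
  match f with
  | .prepFlip t b q => (t, Gate.prep b q) ∈ C
  | .measFlip t b q => (t, Gate.meas b q) ∈ C
  | .cnotPauli t c g P P' => (t, Gate.cnot c g) ∈ C ∧ (P, P') ≠ 0
  | .idlePauli t q P =>
      (∀ g, (t, g) ∈ C → ¬ g.ActsOn q) ∧ (∃ a ∈ C, t ≤ a.1) ∧ P ≠ 0

/-- The Pauli operator that a fault inserts on the qubit `q` directly after the time step `s`. -/
def Fault.error {Q : Type} [DecidableEq Q] (f : Fault Q) (s : ℕ) (q : Q) : Pauli :=
  match f with
  | .prepFlip t b p => if t = s ∧ p = q then b.flip else 0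
  | .measFlip _ _ _ => 0
  | .cnotPauli t c g P P' => if t = s then (if q = c then P else if q = g then P' else 0) else 0
  | .idlePauli t p P => if t = s ∧ p = q then P else 0

/-- `1` when the fault is the classical flip of the outcome of the measurement of the qubit `q` in
the basis `b` at the time step `s`. -/
def Fault.readout {Q : Type} [DecidableEq Q] (f : Fault Q) (s : ℕ) (b : Basis) (q : Q) : ZMod 2 :=
  match f with
  | .measFlip t b' p => if t = s ∧ b' = b ∧ p = q then 1 else 0
  | _ => 0

/-- The Pauli frame of the error configuration `E` just before the time step `t`: the Pauli operator
by which the faults of the earlier time steps, propagated through the circuit, have changed the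
state. -/
def frame {Q : Type} [DecidableEq Q] (C : Circuit Q) (E : Finset (Fault Q)) : ℕ → Q → Pauli
  | 0 => 0
  | t + 1 => fun q =>
      frame C E t q + ∑ a ∈ C.filter (fun a => a.1 = t), a.2.kick (frame C E t) q
        + ∑ f ∈ E, f.error t q

/-- Whether (`1`) or not (`0`) the error configuration `E` flips the outcome of the measurement of
the qubit `q` in the basis `b` at the time step `t`. -/
def outcomeFlip {Q : Type} [DecidableEq Q] (C : Circuit Q) (E : Finset (Fault Q))
    (t : ℕ) (b : Basis) (q : Q) : ZMod 2 :=
  b.detects (frame C E t q) + ∑ f ∈ E, f.readout t b q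

/-! ### CSS codes and syndrome extraction circuits -/

/-- A CSS code with `X` checks `ι`, `Z` checks `κ` and data qubits `D`. -/
structure CSSCode (ι κ D : Type) [Fintype D] where
  HX : Matrix ι D (ZMod 2)
  HZ : Matrix κ D (ZMod 2)
  comm : HX * HZ.transpose = 0

section

variable {ι κ D : Type} [Fintype ι] [Fintype κ] [Fintype D]
  [DecidableEq ι] [DecidableEq κ] [DecidableEq D]

/-- The set of data qubits in a check; `Sum.inl i` is an `X` check and `Sum.inr k` a `Z` check. -/
def CSSCode.support (C : CSSCode ι κ D) : ι ⊕ κ → Finset D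
  | .inl i => Finset.univ.filter fun j => C.HX i j = 1
  | .inr k => Finset.univ.filter fun j => C.HZ k j = 1

/-- The basis in which the ancilla of a check is prepared and measured. -/
def checkBasis : ι ⊕ κ → Basis
  | .inl _ => .X
  | .inr _ => .Z

/-- The qubits of an extraction circuit: the data qubits and one ancilla for each check. -/
abbrev Qubit (ι κ D : Type) : Type := D ⊕ (ι ⊕ κ)

/-- The CNOT between the ancilla of a check and a data qubit: the ancilla of an `X` check is the
control, the ancilla of a `Z` check is the target. -/
def checkCnot (c : ι ⊕ κ) (j : D) : Gate (Qubit ι κ D) :=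
  match c with
  | .inl i => .cnot (.inr (.inl i)) (.inl j)
  | .inr k => .cnot (.inl j) (.inr (.inr k))

/-- A (repeated, possibly staggered) single-ancilla, CNOT-based syndrome extraction circuit. For
each check it specifies the time steps, within a round, of the preparation of the ancilla, of the
CNOTs with the data qubits in its support and of the measurement of the ancilla. In round `r` these
are shifted by `start r`; rounds may overlap in time, but on each single qubit the operations of a
round precede those of the later rounds. -/
structure SEC (C : CSSCode ι κ D) where
  prep : ι ⊕ κ → ℕ
  cnot : ι ⊕ κ → D → ℕ
  meas : ι ⊕ κ → ℕ
  start : ℕ → ℕ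
  prep_lt_cnot : ∀ c, ∀ j ∈ C.support c, prep c < cnot c j
  cnot_lt_meas : ∀ c, ∀ j ∈ C.support c, cnot c j < meas c
  /-- The ancilla takes part in one CNOT at a time. -/
  cnot_ne_of_check : ∀ c, ∀ j ∈ C.support c, ∀ j' ∈ C.support c, j ≠ j' → cnot c j ≠ cnot c j'
  /-- A data qubit takes part in one CNOT at a time. -/
  cnot_ne_of_data : ∀ c c' j, j ∈ C.support c → j ∈ C.support c' → c ≠ c' → cnot c j ≠ cnot c' j
  round_ancilla : ∀ r s, r < s → ∀ c, start r + meas c < start s + prep c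
  round_data : ∀ r s, r < s → ∀ c c' j, j ∈ C.support c → j ∈ C.support c' →
    start r + cnot c j < start s + cnot c' j
  /-- The circuit measures the checks: an `X` check acts before a `Z` check on an even number of
  their common data qubits. (Non-interleaved circuits always satisfy this.) -/
  measures_checks : ∀ i k,
    Even ((C.support (.inl i) ∩ C.support (.inr k)).filter
      (fun j => cnot (.inl i) j < cnot (.inr k) j)).card

namespace SEC

variable {C : CSSCode ι κ D}

/-- All `X`-type CNOTs precede all `Z`-type CNOTs of the same round on the same data qubit, or the
other way round. -/
def NonInterleaved (S : SEC C) : Prop :=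
  (∀ i k j, j ∈ C.support (.inl i) → j ∈ C.support (.inr k) →
    S.cnot (.inl i) j < S.cnot (.inr k) j) ∨
  (∀ i k j, j ∈ C.support (.inl i) → j ∈ C.support (.inr k) →
    S.cnot (.inr k) j < S.cnot (.inl i) j)

/-- In a memory experiment the data qubits are prepared at time step `0`, and round `r` is shifted
by `begin r`. -/
def begin (S : SEC C) (r : ℕ) : ℕ := S.start r + 1

/-- The time step, after the end of all `m` rounds, at which the data qubits are measured. -/
def readoutTime (S : SEC C) (m : ℕ) : ℕ :=
  (Finset.range m).sup (fun r => Finset.univ.sup (fun c => S.begin r + S.meas c)) + 1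

/-- The memory experiment in the basis `b` with `m` rounds: all data qubits are prepared in the
basis `b`, `m` rounds of the extraction circuit are run, and all data qubits are measured in the
basis `b`. -/
def memory (S : SEC C) (b : Basis) (m : ℕ) : Circuit (Qubit ι κ D) :=
  (Finset.univ.image fun j : D => (0, Gate.prep b (.inl j)))
  ∪ ((Finset.range m).biUnion fun r => Finset.univ.biUnion fun c : ι ⊕ κ =>
      {(S.begin r + S.prep c, Gate.prep (checkBasis c) (.inr c))}
      ∪ ((C.support c).image fun j => (S.begin r + S.cnot c j, checkCnot c j))
      ∪ {(S.begin r + S.meas c, Gate.meas (checkBasis c) (.inr c))})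
  ∪ (Finset.univ.image fun j : D => (S.readoutTime m, Gate.meas b (.inl j)))

/-- The fault is a flip of the initial preparation or of the final measurement of a data qubit. -/
def IsBoundary (f : Fault (Qubit ι κ D)) : Prop :=
  match f with
  | .prepFlip _ _ (.inl _) => True
  | .measFlip _ _ (.inl _) => True
  | _ => False

/-- The error configurations of the memory experiment: the finite sets of its error mechanisms. The
initial preparation and the final measurement of the data qubits are noisy if `noisyBoundary` is
`true`, and perfect otherwise. -/
def IsConfiguration (S : SEC C) (b : Basis) (m : ℕ) (noisyBoundary : Bool)
    (E : Finset (Fault (Qubit ι κ D))) : Prop :=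
  ∀ f ∈ E, f.OccursIn (S.memory b m) ∧ (noisyBoundary = true ∨ ¬ IsBoundary f)

/-- Whether the outcome of the check `c` in round `r` is flipped. -/
def checkFlip (S : SEC C) (b : Basis) (m : ℕ) (E : Finset (Fault (Qubit ι κ D)))
    (r : ℕ) (c : ι ⊕ κ) : ZMod 2 :=
  outcomeFlip (S.memory b m) E (S.begin r + S.meas c) (checkBasis c) (.inr c)

/-- Whether the outcome of the final measurement of the data qubit `j` is flipped. -/
def dataFlip (S : SEC C) (b : Basis) (m : ℕ) (E : Finset (Fault (Qubit ι κ D)))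
    (j : D) : ZMod 2 :=
  outcomeFlip (S.memory b m) E (S.readoutTime m) b (.inl j)

/-- No detector is flipped. The detectors compare the outcomes of each check in consecutive rounds.
For the checks of the type `b`, moreover, the outcome in the first round is a detector by itself,
and the outcome in the last round is compared with the value of the check that is computed from the
final measurement of the data qubits. -/
def Undetected (S : SEC C) (b : Basis) (m : ℕ) (E : Finset (Fault (Qubit ι κ D))) : Prop :=
  (∀ r c, r + 1 < m → S.checkFlip b m E r c + S.checkFlip b m E (r + 1) c = 0) ∧
  (∀ c, checkBasis c = b → 0 < m → S.checkFlip b m E 0 c = 0) ∧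
  (∀ c, checkBasis c = b → 0 < m →
    S.checkFlip b m E (m - 1) c + ∑ j ∈ C.support c, S.dataFlip b m E j = 0)

/-- The supports of the logical operators of type `b`: they commute with the checks of the other
type and are not products of checks of the type `b`. -/
def IsLogical (C : CSSCode ι κ D) (b : Basis) (v : D → ZMod 2) : Prop :=
  match b with
  | .X => C.HZ.mulVec v = 0 ∧ v ∉ Submodule.span (ZMod 2) (Set.range C.HX.row)
  | .Z => C.HX.mulVec v = 0 ∧ v ∉ Submodule.span (ZMod 2) (Set.range C.HZ.row)

/-- The error configuration flips at least one logical observable of type `b`, as it is read off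
from the final measurement of the data qubits. -/
def FlipsLogical (S : SEC C) (b : Basis) (m : ℕ) (E : Finset (Fault (Qubit ι κ D))) : Prop :=
  ∃ v, IsLogical C b v ∧ ∑ j, v j * S.dataFlip b m E j = 1

/-- The circuit distance for the memory experiment in the basis `b` with `m` rounds: the least
number of error mechanisms that flip no detector but at least one logical observable (`⊤` if there
are none). -/
noncomputable def basisDistance (S : SEC C) (m : ℕ) (noisyBoundary : Bool) (b : Basis) : ℕ∞ :=
  sInf {n : ℕ∞ | ∃ E : Finset (Fault (Qubit ι κ D)), S.IsConfiguration b m noisyBoundary E ∧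
    S.Undetected b m E ∧ S.FlipsLogical b m E ∧ n = (E.card : ℕ∞)}

/-- The circuit distance: the smaller one of the distances for the two bases. -/
noncomputable def circuitDistance (S : SEC C) (m : ℕ) (noisyBoundary : Bool) : ℕ∞ :=
  min (S.basisDistance m noisyBoundary .X) (S.basisDistance m noisyBoundary .Z)

end SEC

end

/-! ### The gross code -/

/-- The group `⟨x⟩ × ⟨y⟩` with `x ^ 12 = y ^ 6 = 1`, written additively: `(a, b)` is `x^a y^b`. -/
abbrev GrossGroup : Type := ZMod 12 × ZMod 6

/-- The polynomial `x ^ 3 + y + y ^ 2`, as the set of its monomials. -/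
def grossA : Finset GrossGroup := {(3, 0), (0, 1), (0, 2)}

/-- The polynomial `y ^ 3 + x + x ^ 2`, as the set of its monomials. -/
def grossB : Finset GrossGroup := {(0, 3), (1, 0), (2, 0)}

/-- The matrix of a polynomial `P` in the cyclic shifts `x` and `y`. -/
def shiftMatrix (P : Finset GrossGroup) : Matrix GrossGroup GrossGroup (ZMod 2) :=
  Matrix.of fun g h => if h - g ∈ P then 1 else 0

/-- The gross code: `H_X = [A | B]` and `H_Z = [Bᵀ | Aᵀ]`. -/
def grossCode : CSSCode GrossGroup GrossGroup (GrossGroup ⊕ GrossGroup) where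
  HX := Matrix.fromCols (shiftMatrix grossA) (shiftMatrix grossB)
  HZ := Matrix.fromCols (shiftMatrix grossB).transpose (shiftMatrix grossA).transpose
  comm := by
    rw [Matrix.transpose_fromCols, Matrix.fromCols_mul_fromRows, Matrix.transpose_transpose,
      Matrix.transpose_transpose]
    ext g k
    have h : ∑ h, shiftMatrix grossB g h * shiftMatrix grossA h k
        = ∑ h, shiftMatrix grossA g h * shiftMatrix grossB h k := by
      refine Fintype.sum_equiv (Equiv.subLeft (g + k)) _ _ fun h => ?_
      have e1 : g + k - h - g = k - h := by abel
      have e2 : k - (g + k - h) = h - g := by abel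
      simp only [shiftMatrix, Matrix.of_apply, Equiv.subLeft_apply, e1, e2, mul_comm]
    rw [Matrix.add_apply, Matrix.mul_apply, Matrix.mul_apply, h, CharTwo.add_self_eq_zero]
    rfl

/-- The translation by `u` of the data qubits of the gross code. -/
def shiftData (u : GrossGroup) : GrossGroup ⊕ GrossGroup → GrossGroup ⊕ GrossGroup :=
  Sum.map (u + ·) (u + ·)

/-- All `X` checks use the same local order of their CNOTs, up to translation. -/
def UniformlyTiled (S : SEC grossCode) : Prop :=
  ∀ g u : GrossGroup, ∀ j ∈ grossCode.support (.inl g), ∀ j' ∈ grossCode.support (.inl g),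
    (S.cnot (.inl g) j < S.cnot (.inl g) j' ↔
      S.cnot (.inl (u + g)) (shiftData u j) < S.cnot (.inl (u + g)) (shiftData u j'))

set_option linter.unusedSectionVars false

/-! It suffices to bound the `Z`-basis distance, using only `X`-type faults after CNOTs of `X`
checks in the first round. An `X` on the data qubit is an ordinary data error. An `X` on the ancilla
spreads to the data qubits that the check has still to visit: a hook error.

In a non-interleaved circuit the `Z` checks of the first round see either all of the resulting data
error `e` or none of it, and later rounds see all of it. So if `HZ e = 0`, nothing is detected, and
`e` flips every logical `Z` operator `v` with `v ⬝ᵥ e = 1` (`basisDistance_le_card_faultyCnots`).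

Multiplying by an `X` check, a hook after the second CNOT becomes an error on the first two ports
visited, and a hook after the fourth is an error on the last two. Hence every order provides two
disjoint pairs of ports at the price of one fault per pair (`exists_isHook`), and uniform tiling
provides the same pairs at every `X` check. For 13 of the 15 pairs an explicit logical `X` error
consists of such pairs and single qubits, at most ten in all (`pairErrors`). The pairs `(0, 1)` and
`(3, 4)` are not in this table. If one of the two available pairs is in the table, it suffices;
otherwise they are exactly these two, and a logical error that mixes both kinds also costs ten
faults. -/

theorem Finset.sum_filter_lt_succ {α M : Type*} [AddCommMonoid M] (s : Finset α) (T : α → ℕ)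
    (f : α → M) (t : ℕ) :
    ∑ x ∈ s with T x < t + 1, f x = ∑ x ∈ s with T x < t, f x + ∑ x ∈ s with T x = t, f x := by
  simp only [Finset.sum_filter, ← Finset.sum_add_distrib]
  refine Finset.sum_congr rfl fun x _ => ?_
  rcases lt_trichotomy (T x) t with h | h | h
  · simp [h, h.ne, h.trans (Nat.lt_succ_self t)]
  · simp [h]
  · simp [h.ne', h.not_gt, show ¬ T x < t + 1 by omega]

namespace SEC

section

variable {ι κ D : Type} [Fintype ι] [Fintype κ] [Fintype D]
  [DecidableEq ι] [DecidableEq κ] [DecidableEq D] {C : CSSCode ι κ D}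

theorem mem_memory (S : SEC C) (b : Basis) (m : ℕ) (x : ℕ × Gate (Qubit ι κ D)) :
    x ∈ S.memory b m ↔ (∃ j, x = (0, .prep b (.inl j))) ∨
      (∃ r < m, ∃ c, x = (S.begin r + S.prep c, .prep (checkBasis c) (.inr c)) ∨
        (∃ j ∈ C.support c, x = (S.begin r + S.cnot c j, checkCnot c j)) ∨
        x = (S.begin r + S.meas c, .meas (checkBasis c) (.inr c))) ∨
      ∃ j, x = (S.readoutTime m, .meas b (.inl j)) := by
  simp only [memory, Finset.mem_union, Finset.mem_image, Finset.mem_univ, true_and,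
    Finset.mem_biUnion, Finset.mem_range, Finset.mem_singleton, or_assoc, eq_comm (a := x)]

/-! ### Gates that change the `X` part of the frame -/

/-- CNOTs copy `Z` only from `Z`, so frames of pure `X` type remain so; this is why the `X` checks
never fire below. -/
theorem kick_snd_eq_zero {Q : Type} [DecidableEq Q] (g : Gate Q) {F : Q → Pauli}
    (hF : ∀ q, (F q).2 = 0) (q : Q) : (g.kick F q).2 = 0 := by
  cases g with
  | prep b p =>
    simp only [Gate.kick]
    split_ifs <;> simp [hF]
  | meas b p => rfl
  | cnot c t => simp [Gate.kick, hF]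

/-- The ancilla of an `X` check is always a control, so no CNOT copies an `X` onto it. -/
theorem kick_xAncilla (S : SEC C) {b : Basis} {m : ℕ} {x : ℕ × Gate (Qubit ι κ D)}
    (hx : x ∈ S.memory b m) (F : Qubit ι κ D → Pauli) (i : ι) :
    (x.2.kick F (.inr (.inl i))).1 = 0 ∨
      ∃ r < m, x = (S.begin r + S.prep (.inl i), .prep .X (.inr (.inl i))) := by
  rcases (S.mem_memory b m x).1 hx with ⟨j, rfl⟩ | ⟨r, hr, c, rfl | ⟨j, hj, rfl⟩ | rfl⟩ | ⟨j, rfl⟩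
  · simp [Gate.kick]
  · by_cases h : c = .inl i
    · subst h
      exact .inr ⟨r, hr, rfl⟩
    · left
      simp [Gate.kick, Ne.symm h]
  · left
    cases c <;> simp [Gate.kick, checkCnot]
  · simp [Gate.kick]
  · simp [Gate.kick]

/-- A data qubit is a target only for `X` checks. The hypothesis `hF` disposes of the initial
preparation at time `0`, which erases whatever frame it meets. -/
theorem kick_data (S : SEC C) {b : Basis} {m : ℕ} {x : ℕ × Gate (Qubit ι κ D)}
    (hx : x ∈ S.memory b m) (F : Qubit ι κ D → Pauli) (j : D) (hF : x.1 = 0 → (F (.inl j)).1 = 0) :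
    (x.2.kick F (.inl j)).1 = 0 ∨ ∃ r < m, ∃ i, j ∈ C.support (.inl i) ∧
      x = (S.begin r + S.cnot (.inl i) j, checkCnot (.inl i) j) := by
  rcases (S.mem_memory b m x).1 hx with ⟨j', rfl⟩ | ⟨r, hr, c, rfl | ⟨j', hj, rfl⟩ | rfl⟩ | ⟨j, rfl⟩
  · left
    simp only [Gate.kick]
    split_ifs <;> simp [hF]
  · simp [Gate.kick]
  · cases c with
    | inl i =>
      by_cases h : j = j'
      · subst h
        exact .inr ⟨r, hr, i, hj, rfl⟩
      · left
        simp [Gate.kick, checkCnot, h]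
    | inr k => simp [Gate.kick, checkCnot]
  · simp [Gate.kick]
  · simp [Gate.kick]

theorem kick_zAncilla (S : SEC C) {b : Basis} {m : ℕ} {x : ℕ × Gate (Qubit ι κ D)}
    (hx : x ∈ S.memory b m) (F : Qubit ι κ D → Pauli) (k : κ) :
    (x.2.kick F (.inr (.inr k))).1 = 0 ∨ ∃ r < m,
      x = (S.begin r + S.prep (.inr k), .prep .Z (.inr (.inr k))) ∨
      ∃ j ∈ C.support (.inr k), x = (S.begin r + S.cnot (.inr k) j, checkCnot (.inr k) j) := by
  rcases (S.mem_memory b m x).1 hx with ⟨j, rfl⟩ | ⟨r, hr, c, rfl | ⟨j, hj, rfl⟩ | rfl⟩ | ⟨j, rfl⟩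
  · simp [Gate.kick]
  · by_cases h : c = .inr k
    · subst h
      exact .inr ⟨r, hr, .inl rfl⟩
    · left
      simp [Gate.kick, Ne.symm h]
  · by_cases h : c = .inr k
    · subst h
      exact .inr ⟨r, hr, .inr ⟨j, hj, rfl⟩⟩
    · left
      cases c with
      | inl i => simp [Gate.kick, checkCnot]
      | inr k' => simp [Gate.kick, checkCnot, show k ≠ k' from fun e => h (e ▸ rfl)]
  · simp [Gate.kick]
  · simp [Gate.kick]

/-! ### Faults of the CNOTs of the `X` checks in the first round -/

/-- The `X` checks that contain a data qubit. -/
def xChecks (C : CSSCode ι κ D) (j : D) : Finset ι :=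
  Finset.univ.filter fun i => j ∈ C.support (.inl i)

@[simp]
theorem mem_xChecks {j : D} {i : ι} : i ∈ xChecks C j ↔ j ∈ C.support (.inl i) := by
  simp [xChecks]

/-- The time step of the CNOT between an `X` check and a data qubit in the first round. -/
def firstCnot (S : SEC C) (i : ι) (j : D) : ℕ := S.begin 0 + S.cnot (.inl i) j

/-- The fault that follows a CNOT of an `X` check in the first round by `X ^ a` on the ancilla
and by `X ^ b` on the data qubit. -/
def hookFault (S : SEC C) (a b : ι × D → ZMod 2) (p : ι × D) : Fault (Qubit ι κ D) :=
  .cnotPauli (S.firstCnot p.1 p.2) (.inr (.inl p.1)) (.inl p.2) (a p, 0) (b p, 0)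

theorem hookFault_injective (S : SEC C) (a b : ι × D → ZMod 2) :
    Function.Injective (S.hookFault a b) := by
  rintro ⟨i, j⟩ ⟨i', j'⟩ h
  simp only [hookFault, Fault.cnotPauli.injEq, Sum.inr.injEq, Sum.inl.injEq] at h
  exact Prod.ext h.2.1 h.2.2.1

/-- The CNOTs of the `X` checks that are followed by a fault. -/
def faultyCnots (C : CSSCode ι κ D) (a b : ι × D → ZMod 2) : Finset (ι × D) :=
  Finset.univ.filter fun p => p.2 ∈ C.support (.inl p.1) ∧ (a p ≠ 0 ∨ b p ≠ 0)

/-- The nontrivial ones among the faults `SEC.hookFault`. -/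
def hookFaults (S : SEC C) (a b : ι × D → ZMod 2) : Finset (Fault (Qubit ι κ D)) :=
  (faultyCnots C a b).map ⟨S.hookFault a b, S.hookFault_injective a b⟩

theorem isConfiguration_hookFaults (S : SEC C) (a b : ι × D → ZMod 2) {m : ℕ} (hm : 0 < m)
    (nb : Bool) (B : Basis) : S.IsConfiguration B m nb (S.hookFaults a b) := by
  intro f hf
  simp only [hookFaults, faultyCnots, Finset.mem_map, Finset.mem_filter, Finset.mem_univ,
    true_and, Function.Embedding.coeFn_mk] at hf
  obtain ⟨⟨i, j⟩, ⟨hj, hab⟩, rfl⟩ := hf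
  -- A CNOT fault is never a boundary fault, so the same configuration serves both noise
  -- conventions.
  refine ⟨⟨?_, ?_⟩, .inr (by simp [hookFault, IsBoundary])⟩
  · exact (S.mem_memory B m _).2 (.inr (.inl ⟨0, hm, .inl i, .inr (.inl ⟨j, hj, rfl⟩)⟩))
  · intro h
    simp only [Prod.mk_eq_zero] at h
    exact hab.elim (fun h' => h' h.1.1) (fun h' => h' h.2.1)

theorem sum_error_snd (S : SEC C) (a b : ι × D → ZMod 2) (t : ℕ) (q : Qubit ι κ D) :
    (∑ f ∈ S.hookFaults a b, f.error t q).2 = 0 := by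
  rw [hookFaults, Finset.sum_map, Prod.snd_sum]
  refine Finset.sum_eq_zero fun p _ => ?_
  simp only [Function.Embedding.coeFn_mk, hookFault, Fault.error]
  split_ifs <;> rfl

theorem sum_error_xAncilla (S : SEC C) (a b : ι × D → ZMod 2) (t : ℕ) (i : ι) :
    (∑ f ∈ S.hookFaults a b, f.error t (.inr (.inl i))).1
      = ∑ j ∈ C.support (.inl i) with S.firstCnot i j = t, a (i, j) := by
  rw [hookFaults, Finset.sum_map, Prod.fst_sum, faultyCnots, Finset.sum_filter,
    Fintype.sum_prod_type, Finset.sum_eq_single i]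
  · rw [Finset.sum_filter, ← Finset.sum_subset (Finset.subset_univ (C.support (.inl i)))]
    · refine Finset.sum_congr rfl fun j hj => ?_
      by_cases h : a (i, j) = 0
      · simp only [hj, hookFault, Fault.error, h, Function.Embedding.coeFn_mk]
        split_ifs <;> simp_all
      · simp only [hj, hookFault, Fault.error, ne_eq, h, not_false_eq_true, true_or, true_and,
          if_true, Function.Embedding.coeFn_mk]
        split_ifs <;> rfl
    · intro j _ hj
      simp [hj]
  · intro i' _ hi
    refine Finset.sum_eq_zero fun j _ => ?_
    simp [hookFault, Fault.error, hi.symm]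
  · simp

theorem sum_error_zAncilla (S : SEC C) (a b : ι × D → ZMod 2) (t : ℕ) (k : κ) :
    (∑ f ∈ S.hookFaults a b, f.error t (.inr (.inr k))).1 = 0 := by
  rw [hookFaults, Finset.sum_map, Prod.fst_sum]
  refine Finset.sum_eq_zero fun p _ => ?_
  simp [hookFault, Fault.error]

theorem sum_error_data (S : SEC C) (a b : ι × D → ZMod 2) (t : ℕ) (j : D) :
    (∑ f ∈ S.hookFaults a b, f.error t (.inl j)).1
      = ∑ i ∈ xChecks C j with S.firstCnot i j = t, b (i, j) := by
  rw [hookFaults, Finset.sum_map, Prod.fst_sum, faultyCnots, Finset.sum_filter,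
    Fintype.sum_prod_type_right, Finset.sum_eq_single j]
  · rw [Finset.sum_filter, xChecks, Finset.sum_filter]
    refine Finset.sum_congr rfl fun i _ => ?_
    by_cases hj : j ∈ C.support (.inl i)
    · by_cases h : b (i, j) = 0
      · simp only [hj, hookFault, Fault.error, h, Function.Embedding.coeFn_mk]
        split_ifs <;> simp_all
      · simp only [hj, hookFault, Fault.error, ne_eq, h, not_false_eq_true, or_true, true_and,
          if_true, Function.Embedding.coeFn_mk]
        split_ifs <;> simp_all
    · simp [hj]
  · intro j' _ hj
    refine Finset.sum_eq_zero fun i _ => ?_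
    simp [hookFault, Fault.error, hj.symm]
  · simp

theorem sum_readout (S : SEC C) (a b : ι × D → ZMod 2) (t : ℕ) (B : Basis) (q : Qubit ι κ D) :
    ∑ f ∈ S.hookFaults a b, f.readout t B q = 0 := by
  rw [hookFaults, Finset.sum_map]
  exact Finset.sum_eq_zero fun p _ => rfl

/-! ### The Pauli frame of these faults -/

/-- The Pauli frame of the faults `SEC.hookFaults` in the `Z`-basis experiment. -/
def hookFrame (S : SEC C) (m : ℕ) (a b : ι × D → ZMod 2) : ℕ → Qubit ι κ D → Pauli :=
  frame (S.memory .Z m) (S.hookFaults a b)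

variable (S : SEC C) (m : ℕ) (a b : ι × D → ZMod 2)

theorem hookFrame_succ_fst (t : ℕ) (q : Qubit ι κ D) :
    (S.hookFrame m a b (t + 1) q).1 = (S.hookFrame m a b t q).1
      + ∑ x ∈ S.memory .Z m with x.1 = t, (x.2.kick (S.hookFrame m a b t) q).1
      + (∑ f ∈ S.hookFaults a b, f.error t q).1 := by
  simp only [hookFrame, frame, Prod.fst_add, Prod.fst_sum]

theorem hookFrame_snd (t : ℕ) (q : Qubit ι κ D) : (S.hookFrame m a b t q).2 = 0 := by
  induction t generalizing q with
  | zero => rfl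
  | succ t ih =>
    have h : (S.hookFrame m a b (t + 1) q).2 = (S.hookFrame m a b t q).2
        + ∑ x ∈ S.memory .Z m with x.1 = t, (x.2.kick (S.hookFrame m a b t) q).2
        + (∑ f ∈ S.hookFaults a b, f.error t q).2 := by
      simp only [hookFrame, frame, Prod.snd_add, Prod.snd_sum]
    rw [h, ih, sum_error_snd, Finset.sum_eq_zero fun x _ => kick_snd_eq_zero x.2 ih q]
    simp

/-- Up to its first measurement the ancilla only accumulates its own faults: the preparation of
round `0` precedes all of them, and the later preparations come after the measurement. -/
theorem hookFrame_xAncilla_first {t : ℕ} {i : ι} (ht : t ≤ S.begin 0 + S.meas (.inl i)) :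
    (S.hookFrame m a b t (.inr (.inl i))).1
      = ∑ j ∈ C.support (.inl i) with S.firstCnot i j < t, a (i, j) := by
  induction t with
  | zero => simp [hookFrame, frame]
  | succ t ih =>
    rw [hookFrame_succ_fst, sum_error_xAncilla, Finset.sum_filter_lt_succ, ih (by omega)]
    congr 1
    refine (congrArg _ (Finset.sum_eq_zero fun x hx => ?_)).trans (add_zero _)
    rw [Finset.mem_filter] at hx
    obtain ⟨hx, rfl⟩ := hx
    rcases S.kick_xAncilla hx (S.hookFrame m a b x.1) i with h | ⟨r, hr, rfl⟩
    · exact h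
    · have hr0 : r = 0 := by
        by_contra h0
        have := S.round_ancilla 0 r (Nat.pos_of_ne_zero h0) (.inl i)
        simp only [begin] at ht
        omega
      subst hr0
      have h0 := ih (by omega)
      rw [Finset.sum_eq_zero] at h0
      · simp [Gate.kick, h0]
      · intro j hj
        rw [Finset.mem_filter] at hj
        have := S.prep_lt_cnot (.inl i) j hj.1
        have := hj.2
        simp only [firstCnot] at this
        omega

theorem hookFrame_prep {t r : ℕ} {c : ι ⊕ κ} (ht : t = S.begin r + S.prep c) (hr : r < m)
    (hc : ∀ x ∈ S.memory .Z m, x.1 = t → (x.2.kick (S.hookFrame m a b t) (.inr c)).1 = 0 ∨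
      x = (t, .prep (checkBasis c) (.inr c)))
    (he : (∑ f ∈ S.hookFaults a b, f.error t (.inr c)).1 = 0) :
    (S.hookFrame m a b (t + 1) (.inr c)).1 = 0 := by
  rw [hookFrame_succ_fst, he, Finset.sum_eq_single (t, .prep (checkBasis c) (.inr c))]
  · simpa [Gate.kick] using CharTwo.add_self_eq_zero _
  · intro x hx hne
    rw [Finset.mem_filter] at hx
    exact (hc x hx.1 hx.2).resolve_right hne
  · intro h
    refine absurd ?_ h
    rw [Finset.mem_filter, mem_memory]
    exact ⟨.inr (.inl ⟨r, hr, c, .inl (by rw [ht])⟩), rfl⟩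

/-- The preparation of a later round erases the ancilla error and no fault follows it, so hooks
spread in the first round only. -/
theorem hookFrame_xAncilla_later {t r : ℕ} {i : ι} (hr0 : 0 < r) (hr : r < m)
    (ht : S.begin r + S.prep (.inl i) < t) : (S.hookFrame m a b t (.inr (.inl i))).1 = 0 := by
  induction t with
  | zero => omega
  | succ t ih =>
    have he : (∑ f ∈ S.hookFaults a b, f.error t (.inr (.inl i))).1 = 0 := by
      rw [sum_error_xAncilla, Finset.sum_eq_zero]
      intro j hj
      rw [Finset.mem_filter] at hj
      have h1 := S.round_ancilla 0 r hr0 (.inl i)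
      have h2 := S.cnot_lt_meas (.inl i) j hj.1
      have h3 := hj.2
      simp only [firstCnot, begin] at h3 ht
      omega
    rcases (Nat.lt_succ_iff.1 ht).eq_or_lt with h | h
    · refine S.hookFrame_prep m a b h.symm hr (fun x hx hxt => ?_) he
      rcases S.kick_xAncilla hx (S.hookFrame m a b t) i with h' | ⟨s, hs, rfl⟩
      · exact .inl h'
      · exact .inr (by simp [← hxt, checkBasis])
    · rw [hookFrame_succ_fst, he, ih h, Finset.sum_eq_zero, add_zero, add_zero]
      intro x hx
      rw [Finset.mem_filter] at hx
      rcases S.kick_xAncilla hx.1 (S.hookFrame m a b t) i with h' | ⟨s, hs, rfl⟩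
      · exact h'
      · simp [Gate.kick, ih h]

/-- The data error that a CNOT of an `X` check leaves on a data qubit in the first round. -/
def cnotError (p : ι × D) : ZMod 2 :=
  (∑ j ∈ C.support (.inl p.1) with S.cnot (.inl p.1) j < S.cnot (.inl p.1) p.2, a (p.1, j)) + b p

/-- The data error after the first round. -/
def hookError (j : D) : ZMod 2 := ∑ i ∈ xChecks C j, S.cnotError a b (i, j)

/-- Each first-round CNOT deposits the ancilla error accumulated strictly before it, plus its own
data fault; CNOTs of later rounds have clean ancillas. -/
theorem hookFrame_data (hm : 0 < m) (t : ℕ) (j : D) : (S.hookFrame m a b t (.inl j)).1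
    = ∑ i ∈ xChecks C j with S.firstCnot i j < t, S.cnotError a b (i, j) := by
  induction t with
  | zero => simp [hookFrame, frame]
  | succ t ih =>
    rw [hookFrame_succ_fst, sum_error_data, Finset.sum_filter_lt_succ, ih, add_assoc]
    congr 1
    simp only [cnotError, Finset.sum_add_distrib]
    congr 1
    have hF : ∀ x : ℕ × Gate (Qubit ι κ D), x.1 = t → x.1 = 0 →
        (S.hookFrame m a b t (.inl j)).1 = 0 := by
      intro x h h0
      rw [← h, h0]
      rfl
    have hlater : ∀ r < m, 0 < r → ∀ i, j ∈ C.support (.inl i) →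
        S.begin r + S.cnot (.inl i) j = t → ((checkCnot (.inl i) j : Gate (Qubit ι κ D)).kick
          (S.hookFrame m a b t) (.inl j)).1 = 0 := by
      intro r hr hr0 i hi ht
      have := S.prep_lt_cnot (.inl i) j hi
      simpa [Gate.kick, checkCnot] using
        S.hookFrame_xAncilla_later m a b (i := i) hr0 hr (t := t) (by omega)
    by_cases hex : ∃ i, j ∈ C.support (.inl i) ∧ S.firstCnot i j = t
    · obtain ⟨i, hi, rfl⟩ := hex
      have huniq : ∀ i', j ∈ C.support (.inl i') → S.firstCnot i' j = S.firstCnot i j →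
          i' = i := by
        intro i' hi' h
        by_contra hne
        exact S.cnot_ne_of_data (.inl i') (.inl i) j hi' hi (by simpa using hne)
          (by simpa [firstCnot] using h)
      rw [Finset.sum_eq_single (S.firstCnot i j, checkCnot (.inl i) j),
        Finset.sum_eq_single i]
      · have := S.cnot_lt_meas (.inl i) j hi
        simp only [Gate.kick, checkCnot, if_true]
        rw [S.hookFrame_xAncilla_first m a b (by simp only [firstCnot]; omega)]
        simp only [firstCnot, add_lt_add_iff_left]
      · intro i' hi' hne
        rw [Finset.mem_filter, mem_xChecks] at hi'
        exact absurd (huniq i' hi'.1 hi'.2) hne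
      · intro h
        simp [hi] at h
      · intro x hx hne
        rw [Finset.mem_filter] at hx
        rcases S.kick_data hx.1 (S.hookFrame m a b (S.firstCnot i j)) j (hF x hx.2)
          with h | ⟨r, hr, i', hi', rfl⟩
        · exact h
        · rcases Nat.eq_zero_or_pos r with rfl | hr0
          · have := huniq i' hi' hx.2
            subst this
            exact absurd rfl hne
          · exact hlater r hr hr0 i' hi' hx.2
      · intro h
        refine absurd ?_ h
        rw [Finset.mem_filter, mem_memory]
        exact ⟨.inr (.inl ⟨0, hm, .inl i, .inr (.inl ⟨j, hi, rfl⟩)⟩), rfl⟩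
    · rw [Finset.sum_eq_zero, Finset.sum_eq_zero]
      · intro i hi
        rw [Finset.mem_filter, mem_xChecks] at hi
        exact absurd ⟨i, hi⟩ hex
      · intro x hx
        rw [Finset.mem_filter] at hx
        rcases S.kick_data hx.1 (S.hookFrame m a b t) j (hF x hx.2) with h | ⟨r, hr, i, hi, rfl⟩
        · exact h
        · rcases Nat.eq_zero_or_pos r with rfl | hr0
          · exact absurd ⟨i, hi, hx.2⟩ hex
          · exact hlater r hr hr0 i hi hx.2

/-- The ancilla of a `Z` check is a target: after its reset in round `r` it collects the `X` frame
that each data qubit has at the time of its CNOT. -/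
theorem hookFrame_zAncilla {r : ℕ} (hr : r < m) {k : κ} {t : ℕ}
    (ht : S.begin r + S.prep (.inr k) < t) (ht' : t ≤ S.begin r + S.meas (.inr k)) :
    (S.hookFrame m a b t (.inr (.inr k))).1
      = ∑ j ∈ C.support (.inr k) with S.begin r + S.cnot (.inr k) j < t,
          (S.hookFrame m a b (S.begin r + S.cnot (.inr k) j) (.inl j)).1 := by
  -- The windows from preparation to measurement of this ancilla are disjoint for distinct rounds,
  -- so a time in one of them determines the round.
  have hround : ∀ s u v, S.prep (.inr k) ≤ u → u ≤ S.meas (.inr k) → S.prep (.inr k) ≤ v →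
      v ≤ S.meas (.inr k) → S.begin r + u = S.begin s + v → s = r ∧ v = u := by
    intro s u v hu hu' hv hv' h
    rcases lt_trichotomy s r with hs | rfl | hs
    · have := S.round_ancilla s r hs (.inr k)
      simp only [begin] at h
      omega
    · exact ⟨rfl, by omega⟩
    · have := S.round_ancilla r s hs (.inr k)
      simp only [begin] at h
      omega
  have hcnot : ∀ j ∈ C.support (.inr k), S.prep (.inr k) ≤ S.cnot (.inr k) j ∧
      S.cnot (.inr k) j ≤ S.meas (.inr k) := fun j hj =>
    ⟨(S.prep_lt_cnot _ j hj).le, (S.cnot_lt_meas _ j hj).le⟩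
  have hprep : ∀ j ∈ C.support (.inr k), S.prep (.inr k) < S.cnot (.inr k) j :=
    S.prep_lt_cnot _
  induction t with
  | zero => omega
  | succ t ih =>
    rcases (Nat.lt_succ_iff.1 ht).eq_or_lt with h | h
    · have hle : S.prep (.inr k) ≤ S.meas (.inr k) := by omega
      rw [S.hookFrame_prep m a b h.symm hr ?_ (S.sum_error_zAncilla a b t k),
        Finset.sum_eq_zero]
      · intro j hj
        rw [Finset.mem_filter] at hj
        have := hprep j hj.1
        omega
      · intro x hx hxt
        rcases S.kick_zAncilla hx (S.hookFrame m a b t) k with h' | ⟨s, hs, rfl | ⟨j, hj, rfl⟩⟩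
        · exact .inl h'
        · exact .inr (by simp [← hxt, checkBasis])
        · have := (hround s (S.prep (.inr k)) (S.cnot (.inr k) j) le_rfl hle (hcnot j hj).1
            (hcnot j hj).2 (by rw [h]; exact hxt.symm)).2
          have := hprep j hj
          omega
    · rw [hookFrame_succ_fst, sum_error_zAncilla, add_zero, Finset.sum_filter_lt_succ,
        ih h (by omega)]
      congr 1
      obtain ⟨u, hu⟩ := Nat.exists_eq_add_of_lt h
      have hut : t = S.begin r + (S.prep (.inr k) + u + 1) := by omega
      have hkick : ∀ x ∈ S.memory .Z m, x.1 = t →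
          (x.2.kick (S.hookFrame m a b t) (.inr (.inr k))).1 = 0 ∨
          ∃ j ∈ C.support (.inr k), S.begin r + S.cnot (.inr k) j = t ∧
            x = (t, checkCnot (.inr k) j) := by
        intro x hx hxt
        rcases S.kick_zAncilla hx (S.hookFrame m a b t) k with h' | ⟨s, hs, rfl | ⟨j, hj, rfl⟩⟩
        · exact .inl h'
        · have := (hround s (S.prep (.inr k) + u + 1) (S.prep (.inr k)) (by omega) (by omega)
            le_rfl (by omega) (hut.symm.trans hxt.symm)).2
          omega
        · obtain ⟨rfl, -⟩ := hround s (S.prep (.inr k) + u + 1) (S.cnot (.inr k) j) (by omega)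
            (by omega) (hcnot j hj).1 (hcnot j hj).2 (hut.symm.trans hxt.symm)
          exact .inr ⟨j, hj, hxt, Prod.ext hxt rfl⟩
      by_cases hex : ∃ j ∈ C.support (.inr k), S.begin r + S.cnot (.inr k) j = t
      · obtain ⟨j, hj, hjt⟩ := hex
        have huniq : ∀ j' ∈ C.support (.inr k), S.begin r + S.cnot (.inr k) j' = t → j' = j := by
          intro j' hj' h'
          by_contra hne
          exact S.cnot_ne_of_check (.inr k) j' hj' j hj hne (by omega)
        rw [Finset.sum_eq_single (t, checkCnot (.inr k) j), Finset.sum_eq_single j]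
        · simp [Gate.kick, checkCnot, hjt]
        · intro j' hj' hne
          rw [Finset.mem_filter] at hj'
          exact absurd (huniq j' hj'.1 hj'.2) hne
        · intro h'
          simp [hj, hjt] at h'
        · intro x hx hne
          rw [Finset.mem_filter] at hx
          rcases hkick x hx.1 hx.2 with h' | ⟨j', hj', hjt', rfl⟩
          · exact h'
          · rw [huniq j' hj' hjt'] at hne
            exact absurd rfl hne
        · intro h'
          refine absurd ?_ h'
          rw [Finset.mem_filter, mem_memory]
          exact ⟨.inr (.inl ⟨r, hr, .inr k, .inr (.inl ⟨j, hj, by rw [hjt]⟩)⟩), rfl⟩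
      · rw [Finset.sum_eq_zero, Finset.sum_eq_zero]
        · intro j hj
          rw [Finset.mem_filter] at hj
          exact absurd ⟨j, hj⟩ hex
        · intro x hx
          rw [Finset.mem_filter] at hx
          rcases hkick x hx.1 hx.2 with h' | ⟨j, hj, hjt, rfl⟩
          · exact h'
          · exact absurd ⟨j, hj, hjt⟩ hex

/-! ### The distance of the `Z`-basis experiment -/

theorem sum_support (c : ι ⊕ κ) (e : D → ZMod 2) :
    ∑ j ∈ C.support c, e j = Sum.elim (C.HX.mulVec e) (C.HZ.mulVec e) c := by
  have h : ∀ z y : ZMod 2, (if z = 1 then y else 0) = z * y := by decide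
  cases c <;> simp only [CSSCode.support, Finset.sum_filter, h] <;> rfl

variable {S m a b}

/-- The only use of non-interleaving: a `Z` check sees either none of `S.hookError a b` or all of it
on its support, hence has even parity in both cases. -/
theorem checkFlip_hookFaults (hS : S.NonInterleaved)
    (hne : ∀ k, (C.support (.inr k)).Nonempty) {r : ℕ} (hr : r < m)
    (he : C.HZ.mulVec (S.hookError a b) = 0) (c : ι ⊕ κ) :
    S.checkFlip .Z m (S.hookFaults a b) r c = 0 := by
  rw [checkFlip, outcomeFlip, sum_readout, add_zero]
  change (checkBasis c).detects (S.hookFrame m a b _ _) = 0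
  cases c with
  | inl i => exact S.hookFrame_snd m a b _ _
  | inr k =>
    change (S.hookFrame m a b _ _).1 = 0
    -- That an ancilla is prepared before it is measured follows only by way of some CNOT in
    -- between.
    obtain ⟨j₀, hj₀⟩ := hne k
    have h1 := S.prep_lt_cnot (.inr k) j₀ hj₀
    have h2 := S.cnot_lt_meas (.inr k) j₀ hj₀
    rw [S.hookFrame_zAncilla m a b hr (by omega) le_rfl, Finset.filter_true_of_mem
      (fun j hj => by have := S.cnot_lt_meas (.inr k) j hj; omega)]
    simp only [S.hookFrame_data m a b (Nat.zero_lt_of_lt hr)]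
    -- The exceptional case is the first round with `Z` before `X`, where the data are still clean
    -- when checked.
    by_cases hlast : r = 0 ∧ ∀ i k j, j ∈ C.support (.inl i) → j ∈ C.support (.inr k) →
        S.cnot (.inr k) j < S.cnot (.inl i) j
    · obtain ⟨rfl, hlast⟩ := hlast
      refine Finset.sum_eq_zero fun j hj => Finset.sum_eq_zero fun i hi => ?_
      rw [Finset.mem_filter, mem_xChecks] at hi
      have := hlast i k j hi.1 hj
      have := hi.2
      simp only [firstCnot] at this
      omega
    · refine Eq.trans ?_ (congrFun he k)
      refine Eq.trans ?_ (sum_support (.inr k) _)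
      refine Finset.sum_congr rfl fun j hj => ?_
      rw [hookError, Finset.filter_true_of_mem]
      intro i hi
      rw [mem_xChecks] at hi
      rw [firstCnot]
      rcases Nat.eq_zero_or_pos r with rfl | hr0
      · have := (hS.resolve_right fun h => hlast ⟨rfl, h⟩) i k j hi hj
        omega
      · have := S.round_data 0 r hr0 (.inl i) (.inr k) j hi hj
        simp only [begin]
        omega

theorem dataFlip_hookFaults (hm : 0 < m) (j : D) :
    S.dataFlip .Z m (S.hookFaults a b) j = S.hookError a b j := by
  rw [dataFlip, outcomeFlip, sum_readout, add_zero]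
  change (S.hookFrame m a b _ _).1 = _
  rw [S.hookFrame_data m a b hm, hookError, Finset.filter_true_of_mem]
  intro i hi
  have h1 := S.cnot_lt_meas (.inl i) j (mem_xChecks.1 hi)
  have h2 : S.begin 0 + S.meas (.inl i) ≤
      Finset.univ.sup (fun c => S.begin 0 + S.meas c) :=
    Finset.le_sup (f := fun c => S.begin 0 + S.meas c) (Finset.mem_univ _)
  have h3 := Finset.le_sup (f := fun r => Finset.univ.sup (fun c => S.begin r + S.meas c))
    (Finset.mem_range.2 hm)
  simp only [readoutTime, firstCnot]
  omega

/-- The vectors orthogonal to `e` form a subspace that contains all rows of `HZ`. -/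
theorem not_mem_span_row_of_dotProduct_ne_zero {v e : D → ZMod 2} (he : C.HZ.mulVec e = 0)
    (hv : v ⬝ᵥ e ≠ 0) : v ∉ Submodule.span (ZMod 2) (Set.range C.HZ.row) := by
  intro h
  refine hv ?_
  induction h using Submodule.span_induction with
  | mem x hx =>
    obtain ⟨k, rfl⟩ := hx
    exact congrFun he k
  | zero => exact zero_dotProduct e
  | add x y _ _ hx hy =>
    by_cases h : x ⬝ᵥ e = 0
    · exact (add_dotProduct x y e).trans (by rw [h, zero_add]; by_contra h'; exact h' (hy h'))
    · exact absurd (hx h) h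
  | smul c x _ hx =>
    by_contra h
    rw [smul_dotProduct] at h
    exact h (by rw [hx fun h' => h (by rw [h', smul_zero]), smul_zero])

theorem basisDistance_le_card_faultyCnots (hS : S.NonInterleaved) (hm : 0 < m) (nb : Bool)
    (hne : ∀ k, (C.support (.inr k)).Nonempty)
    {v : D → ZMod 2} (he : C.HZ.mulVec (S.hookError a b) = 0) (hv : C.HX.mulVec v = 0)
    (hve : v ⬝ᵥ S.hookError a b = 1) :
    S.basisDistance m nb .Z ≤ (faultyCnots C a b).card := by
  refine sInf_le ⟨S.hookFaults a b, S.isConfiguration_hookFaults a b hm nb .Z, ⟨?_, ?_, ?_⟩,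
    ⟨v, ⟨hv, ?_⟩, ?_⟩, by rw [hookFaults, Finset.card_map]⟩
  · intro r c hr
    rw [checkFlip_hookFaults hS hne (by omega) he, checkFlip_hookFaults hS hne hr he, add_zero]
  · intro c _ _
    exact checkFlip_hookFaults hS hne hm he c
  · intro c hc _
    rw [checkFlip_hookFaults hS hne (by omega) he, zero_add]
    cases c with
    | inl i => cases hc
    | inr k =>
      simp only [dataFlip_hookFaults hm]
      exact (sum_support (.inr k) _).trans (congrFun he k)
  · exact not_mem_span_row_of_dotProduct_ne_zero he (by rw [hve]; exact one_ne_zero)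
  · simpa only [dataFlip_hookFaults hm, dotProduct] using hve

end

end SEC

/-! ### Lists of points as vectors over `ZMod 2` -/

namespace List

variable {α : Type*} [DecidableEq α]

/-- The indicator function of a list, with multiplicities taken modulo two. -/
def parity (L : List α) : α → ZMod 2 := fun x => L.count x

theorem mem_of_parity_ne_zero {L : List α} {x : α} (h : L.parity x ≠ 0) : x ∈ L := by
  by_contra hx
  exact h (by simp [parity, List.count_eq_zero_of_not_mem hx])

theorem sum_mul_parity [Fintype α] (L : List α) (y : α → ZMod 2) :
    ∑ x, y x * L.parity x = (L.map y).sum := by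
  induction L with
  | nil => simp [parity]
  | cons x L ih =>
    simp only [parity, List.count_cons, Nat.cast_add, mul_add, Finset.sum_add_distrib,
      List.map_cons, List.sum_cons] at ih ⊢
    rw [ih, add_comm]
    simp

theorem sum_map_flatMap_pair {β : Type*} (L : List β) (f f' : β → α) (y : α → ZMod 2) :
    ((L.flatMap fun g => [f g, f' g]).map y).sum
      = (L.map fun g => y (f g) + y (f' g)).sum := by
  induction L with
  | nil => rfl
  | cons g L ih => simp [List.flatMap_cons, ← ih, add_assoc]

end List

/-! ### Pairing the data error with a vector, fault by fault -/

namespace SEC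

section

variable {ι κ D : Type} [Fintype ι] [Fintype κ] [Fintype D]
  [DecidableEq ι] [DecidableEq κ] [DecidableEq D] {C : CSSCode ι κ D}

/-- Interchanging the sums turns the errors received by each qubit into the effect of each fault: an
ancilla fault is paired with the sum of `y` over the ports visited later. -/
theorem dotProduct_hookError (S : SEC C) (a b : ι × D → ZMod 2) (y : D → ZMod 2) :
    y ⬝ᵥ S.hookError a b =
      ∑ p : ι × D, (if p.2 ∈ C.support (.inl p.1) then
        ∑ j ∈ C.support (.inl p.1) with S.cnot (.inl p.1) p.2 < S.cnot (.inl p.1) j, y j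
        else 0) * a p +
      ∑ p : ι × D, (if p.2 ∈ C.support (.inl p.1) then y p.2 else 0) * b p := by
  simp only [dotProduct, hookError, cnotError, xChecks, Finset.sum_add_distrib, mul_add,
    Fintype.sum_prod_type, Finset.sum_filter, Finset.mul_sum]
  congr 1
  · rw [Finset.sum_comm]
    refine Finset.sum_congr rfl fun i _ => ?_
    simp only [ite_mul, zero_mul, ← Finset.sum_filter, Finset.filter_univ_mem, Finset.sum_mul]
    rw [← Finset.sum_subset (Finset.subset_univ (C.support (.inl i)))
      fun j _ hj => by rw [if_neg hj, mul_zero]]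
    simp only [Finset.sum_filter]
    rw [Finset.sum_comm]
    refine Finset.sum_congr rfl fun j hj => ?_
    rw [if_pos hj, Finset.mul_sum]
    exact Finset.sum_congr rfl fun j' _ => mul_ite_zero _ _ _
  · rw [Finset.sum_comm]
    refine Finset.sum_congr rfl fun i _ => Finset.sum_congr rfl fun j _ => ?_
    split_ifs <;> simp

/-- Only an inequality: repeated entries may cancel, and an ancilla error and a data error at the
same CNOT form one fault. -/
theorem card_faultyCnots_parity_le (C : CSSCode ι κ D) (A B : List (ι × D)) :
    (faultyCnots C A.parity B.parity).card ≤ A.length + B.length := by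
  rw [← List.length_append]
  refine (Finset.card_le_card fun p hp => ?_).trans (List.toFinset_card_le (A ++ B))
  rw [faultyCnots, Finset.mem_filter] at hp
  rw [List.mem_toFinset, List.mem_append]
  exact hp.2.2.imp List.mem_of_parity_ne_zero List.mem_of_parity_ne_zero

end

end SEC

/-! ### Hook errors of the gross code -/

/-- The data qubits in the `X` check `g` of the gross code. -/
def port (l : Fin 6) (g : GrossGroup) : GrossGroup ⊕ GrossGroup :=
  shiftData g (![.inl (3, 0), .inl (0, 1), .inl (0, 2), .inr (0, 3), .inr (1, 0), .inr (2, 0)] l)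

theorem port_eq_shiftData (l : Fin 6) (g : GrossGroup) : port l g = shiftData g (port l 0) := by
  simp only [port, shiftData, Sum.map_map]
  congr 1 <;> funext x <;> simp

theorem port_injective (g : GrossGroup) : Function.Injective fun l => port l g := by
  intro l l' h
  have hg : Function.Injective (shiftData g) :=
    Sum.map_injective.2 ⟨add_right_injective g, add_right_injective g⟩
  exact (by decide : Function.Injective (![.inl (3, 0), .inl (0, 1), .inl (0, 2), .inr (0, 3),
    .inr (1, 0), .inr (2, 0)] : Fin 6 → GrossGroup ⊕ GrossGroup)) (hg h)

theorem grossCode_support_inl (g : GrossGroup) :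
    grossCode.support (.inl g) = Finset.univ.map ⟨fun l => port l g, port_injective g⟩ := by
  ext j
  rw [CSSCode.support, Finset.mem_filter, Finset.mem_map]
  cases j <;> simp [grossCode, shiftMatrix, grossA, grossB, port, shiftData, Fin.exists_fin_succ,
    sub_eq_iff_eq_add', eq_comm, or_iff_not_imp_left]

theorem port_mem_support (l : Fin 6) (g : GrossGroup) :
    port l g ∈ grossCode.support (.inl g) := by
  rw [grossCode_support_inl]
  exact Finset.mem_map_of_mem _ (Finset.mem_univ l)

theorem grossCode_support_inr_nonempty (g : GrossGroup) :
    (grossCode.support (.inr g)).Nonempty :=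
  ⟨.inl (g - (1, 0)), by
    simp [CSSCode.support, grossCode, shiftMatrix, grossB]⟩

/-- An `X` check that contains a given data qubit. -/
def hostCheck : GrossGroup ⊕ GrossGroup → GrossGroup :=
  Sum.elim (fun h => h - (3, 0)) fun h => h - (0, 3)

theorem mem_support_hostCheck (j : GrossGroup ⊕ GrossGroup) :
    j ∈ grossCode.support (.inl (hostCheck j)) := by
  cases j <;> simp [CSSCode.support, grossCode, shiftMatrix, grossA, grossB, hostCheck]

/-- Up to an `X` check, a fault on the ancilla directly after its CNOT with the port `k` acts on the
ports `l` and `l'`, where `τ` is the order of the CNOTs. -/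
def IsHook (τ : Fin 6 → ℕ) (k l l' : Fin 6) : Prop :=
  ∀ f : Fin 6 → ZMod 2, ∑ x, f x = 0 → ∑ x with τ k < τ x, f x = f l + f l'

/-- The two hooks are those after the second and the fourth CNOT. Their pairs, the first two and the
last two ports visited, are disjoint; of this only the difference of the smaller elements is needed.
-/
theorem exists_isHook {τ : Fin 6 → ℕ} (hτ : Function.Injective τ) :
    ∃ k l l' k₁ l₁ l₁', IsHook τ k l l' ∧ IsHook τ k₁ l₁ l₁' ∧ l < l' ∧ l₁ < l₁' ∧ l ≠ l₁ := by
  set σ := Tuple.sort τ with hσ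
  have hmono : StrictMono (τ ∘ σ) :=
    (Tuple.monotone_sort τ).strictMono_of_injective (hτ.comp σ.injective)
  have hsum : ∀ (f : Fin 6 → ZMod 2) (k : Fin 6),
      ∑ x with τ (σ k) < τ x, f x = ∑ x with k < x, f (σ x) := by
    intro f k
    rw [Finset.sum_filter, Finset.sum_filter, ← Equiv.sum_comp σ]
    exact Finset.sum_congr rfl fun x _ => if_congr hmono.lt_iff_lt rfl rfl
  have horder : ∀ {k u v : Fin 6}, u ≠ v → (∀ f : Fin 6 → ZMod 2, ∑ x, f x = 0 →
      ∑ x with τ k < τ x, f x = f u + f v) → ∃ l l', IsHook τ k l l' ∧ l < l' ∧ (l = u ∨ l = v) := by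
    intro k u v huv h
    rcases huv.lt_or_gt with hlt | hlt
    · exact ⟨u, v, h, hlt, .inl rfl⟩
    · exact ⟨v, u, fun f hf => (h f hf).trans (add_comm _ _), hlt, .inr rfl⟩
  have hne : ∀ {u v : Fin 6}, u ≠ v → σ u ≠ σ v := fun h => σ.injective.ne h
  -- Four ports come after the second CNOT; as `f` has total sum zero, they can be exchanged for the
  -- first two.
  obtain ⟨l, l', h, hl, hl'⟩ := horder (k := σ 1) (u := σ 0) (v := σ 1) (hne (by decide)) (by
    intro f hf
    rw [hsum]
    rw [← Equiv.sum_comp σ, Fin.sum_univ_six] at hf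
    rw [Finset.sum_filter, Fin.sum_univ_six]
    simp only [Fin.reduceLT, if_true, if_false]
    linear_combination hf - (f (σ 0) + f (σ 1)) * CharTwo.two_eq_zero (R := ZMod 2))
  obtain ⟨l₁, l₁', h₁, hl₁, hl₁'⟩ := horder (k := σ 3) (u := σ 4) (v := σ 5) (hne (by decide)) (by
    intro f hf
    rw [hsum, Finset.sum_filter, Fin.sum_univ_six]
    simp [Fin.reduceLT])
  refine ⟨_, l, l', _, l₁, l₁', h, h₁, hl, hl₁, ?_⟩
  rcases hl' with rfl | rfl <;> rcases hl₁' with rfl | rfl <;> exact hne (by decide)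

/-- The data qubits at the ports `l` and `l'` of the `X` checks in `H`. -/
def portPairs (l l' : Fin 6) (H : List GrossGroup) : List (GrossGroup ⊕ GrossGroup) :=
  H.flatMap fun g => [port l g, port l' g]

/-- The support of a logical `Z` operator. -/
def zLogical : List (GrossGroup ⊕ GrossGroup) :=
  [.inl (1, 3), .inl (1, 4), .inl (2, 2), .inl (4, 0), .inl (6, 4), .inl (6, 5), .inl (10, 5),
    .inl (11, 4), .inr (1, 3), .inr (2, 3), .inr (3, 1), .inr (5, 5), .inr (6, 4), .inr (7, 2),
    .inr (7, 4), .inr (8, 1)]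

/-- The `X` errors on `L` commute with the `Z` checks but not with `zLogical`. -/
def FlipsZLogical (L : List (GrossGroup ⊕ GrossGroup)) : Prop :=
  (∀ k, (L.map (grossCode.HZ k)).sum = 0) ∧ (L.map zLogical.parity).sum = 1

instance (L : List (GrossGroup ⊕ GrossGroup)) : Decidable (FlipsZLogical L) :=
  inferInstanceAs (Decidable (_ ∧ _))

theorem HX_mulVec_zLogical : grossCode.HX.mulVec zLogical.parity = 0 := by
  have h : ∀ g, (zLogical.map (grossCode.HX g)).sum = 0 := by decide +kernel
  funext g
  exact (zLogical.sum_mul_parity _).trans (h g)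

/-- One ancilla fault pays for each pair and one data fault for each single qubit. The true data
error agrees with the listed one only up to `X` checks, so the two are compared by pairing with
vectors `y` in the kernel of `HX`. -/
theorem basisDistance_le_of_isHook {S : SEC grossCode} (hS : S.NonInterleaved)
    (hU : UniformlyTiled S) {m : ℕ} (hm : 0 < m) (nb : Bool) {k l l' k₁ l₁ l₁' : Fin 6}
    (h : IsHook (fun x => S.cnot (.inl 0) (port x 0)) k l l')
    (h₁ : IsHook (fun x => S.cnot (.inl 0) (port x 0)) k₁ l₁ l₁')
    {H H₁ : List GrossGroup} {L : List (GrossGroup ⊕ GrossGroup)}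
    (hL : FlipsZLogical (portPairs l l' H ++ portPairs l₁ l₁' H₁ ++ L)) :
    S.basisDistance m nb .Z ≤ (H.length + H₁.length + L.length : ℕ) := by
  set A : List (GrossGroup × (GrossGroup ⊕ GrossGroup)) :=
    H.map (fun g => (g, port k g)) ++ H₁.map (fun g => (g, port k₁ g)) with hA
  set B : List (GrossGroup × (GrossGroup ⊕ GrossGroup)) := L.map (fun j => (hostCheck j, j)) with hB
  have hook : ∀ {k l l' : Fin 6}, IsHook (fun x => S.cnot (.inl 0) (port x 0)) k l l' →
      ∀ {y : GrossGroup ⊕ GrossGroup → ZMod 2}, grossCode.HX.mulVec y = 0 → ∀ g,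
      (∑ j ∈ grossCode.support (.inl g) with S.cnot (.inl g) (port k g) < S.cnot (.inl g) j, y j)
        = y (port l g) + y (port l' g) := by
    intro k l l' h y hy g
    rw [← h (fun x => y (port x g)), grossCode_support_inl, Finset.sum_filter, Finset.sum_map,
      Finset.sum_filter]
    · refine Finset.sum_congr rfl fun x _ => if_congr ?_ rfl rfl
      -- Uniform tiling carries the order at the check `0` to the check `g`.
      have := hU 0 g (port k 0) (port_mem_support k 0) (port x 0) (port_mem_support x 0)
      rw [add_zero, ← port_eq_shiftData, ← port_eq_shiftData] at this
      exact this.symm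
    · have h0 := (SEC.sum_support (.inl g) y).trans (congrFun hy g)
      rwa [grossCode_support_inl, Finset.sum_map] at h0
  have hdot : ∀ y : GrossGroup ⊕ GrossGroup → ZMod 2, grossCode.HX.mulVec y = 0 →
      y ⬝ᵥ S.hookError A.parity B.parity
        = ((portPairs l l' H ++ portPairs l₁ l₁' H₁ ++ L).map y).sum := by
    intro y hy
    rw [S.dotProduct_hookError, List.sum_mul_parity, List.sum_mul_parity]
    simp only [hA, hB, List.map_append, List.sum_append, List.map_map, Function.comp_def,
      port_mem_support, mem_support_hostCheck, if_true, hook h hy, hook h₁ hy, portPairs,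
      List.sum_map_flatMap_pair]
  refine (SEC.basisDistance_le_card_faultyCnots hS hm nb grossCode_support_inr_nonempty
    (a := A.parity) (b := B.parity) ?_ HX_mulVec_zLogical ((hdot _ HX_mulVec_zLogical).trans hL.2)
    ).trans (Nat.cast_le.2 ((SEC.card_faultyCnots_parity_le _ A B).trans (by simp [hA, hB])))
  funext k
  -- Rows of `HZ` lie in the kernel of `HX` because the checks commute.
  refine (hdot (grossCode.HZ k) ?_).trans (hL.1 k)
  funext g
  exact congrFun (congrFun grossCode.comm g) k

/-- For pairs of ports, a set of `X` checks and a set of data qubits that together support an `X`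
error which flips `zLogical`. -/
def pairErrors : List ((Fin 6 × Fin 6) × List GrossGroup × List (GrossGroup ⊕ GrossGroup)) :=
  [((0, 2), [(8, 4), (9, 5)], [.inl (1, 1), .inr (0, 1), .inr (2, 4), .inr (2, 5), .inr (5, 3),
      .inr (9, 3), .inr (9, 4), .inr (10, 5)]),
    ((1, 2), [(7, 2), (7, 5), (8, 2), (8, 5)], [.inr (7, 0), .inr (7, 1), .inr (7, 3),
      .inr (7, 4)]),
    ((0, 3), [(1, 3), (9, 3)], [.inl (1, 4), .inl (3, 1), .inl (5, 4), .inl (7, 1), .inr (1, 1),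
      .inr (2, 2), .inr (5, 1), .inr (6, 2)]),
    ((1, 3), [(1, 4), (3, 0), (5, 2), (7, 4), (9, 0), (11, 2)], []),
    ((2, 3), [(4, 3), (5, 1), (5, 3)], [.inl (4, 1), .inl (6, 0), .inl (6, 4), .inr (4, 3),
      .inr (4, 4), .inr (4, 5)]),
    ((0, 4), [(1, 5), (3, 1), (5, 3), (7, 5), (9, 1), (11, 3)], []),
    ((1, 4), [(6, 5), (7, 0)], [.inl (6, 5), .inl (7, 5), .inl (8, 3), .inl (8, 5), .inl (9, 0),
      .inr (6, 1), .inr (7, 0), .inr (7, 3)]),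
    ((2, 4), [(0, 4), (1, 0), (4, 5), (5, 0)], [.inl (7, 5), .inr (0, 2), .inr (2, 5),
      .inr (9, 4)]),
    ((0, 5), [(4, 0), (4, 2), (5, 1), (5, 3)], [.inl (6, 2), .inl (6, 4), .inr (6, 1),
      .inr (6, 3)]),
    ((1, 5), [(1, 4), (6, 0), (10, 0)], [.inl (7, 2), .inl (9, 5), .inl (11, 2), .inr (7, 4),
      .inr (7, 5), .inr (11, 5)]),
    ((2, 5), [(0, 5), (2, 1), (4, 3), (6, 5), (8, 1), (10, 3)], []),
    ((3, 5), [(0, 0), (3, 4), (6, 3), (9, 1)], [.inl (1, 2), .inl (5, 2), .inl (7, 5),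
      .inl (11, 5)]),
    ((4, 5), [(2, 3), (3, 4)], [.inl (3, 1), .inl (3, 2), .inl (4, 1), .inl (4, 5), .inl (5, 3),
      .inl (5, 5), .inl (6, 4), .inr (4, 5)])]

/-- Each entry of the table covers at most 12 data qubits, and each contains at least two pairs, so
at least two faults are saved. Three entries consist of six pairs alone. -/
theorem flipsZLogical_of_mem_pairErrors : ∀ x ∈ pairErrors,
    FlipsZLogical (portPairs x.1.1 x.1.2 x.2.1 ++ x.2.2) ∧ x.2.1.length + x.2.2.length ≤ 10 := by
  decide +kernel

theorem exists_mem_pairErrors : ∀ l l' : Fin 6, l < l' → (l, l') ≠ (0, 1) → (l, l') ≠ (3, 4) →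
    ∃ x ∈ pairErrors, x.1 = (l, l') := by
  decide +kernel

/-- The mixed case: two pairs of each kind and six single qubits, again ten faults. -/
theorem flipsZLogical_portPairs_zero_one_three_four :
    FlipsZLogical (portPairs 0 1 [(10, 5), (11, 2)] ++ portPairs 3 4 [(0, 1), (3, 5)] ++
      [.inl (3, 2), .inl (4, 2), .inr (0, 2), .inr (0, 3), .inr (4, 4), .inr (7, 3)]) := by
  decide +kernel

theorem mainTheorem4 (S : SEC grossCode) (hS : S.NonInterleaved) (hU : UniformlyTiled S)
    (m : ℕ) (hm : 1 ≤ m) (noisyBoundary : Bool) :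
    S.circuitDistance m noisyBoundary ≤ 10 := by
  refine (min_le_right _ _).trans ?_
  have hinj : Function.Injective fun x => S.cnot (.inl 0) (port x 0) := by
    intro x y h
    by_contra hne
    exact S.cnot_ne_of_check (.inl 0) _ (port_mem_support x 0) _ (port_mem_support y 0)
      ((port_injective 0).ne hne) h
  obtain ⟨k, l, l', k₁, l₁, l₁', h, h₁, hl, hl₁, hne⟩ := exists_isHook hinj
  have hpair : ∀ {k l l' : Fin 6}, IsHook (fun x => S.cnot (.inl 0) (port x 0)) k l l' → l < l' →
      (l, l') ≠ (0, 1) → (l, l') ≠ (3, 4) → S.basisDistance m noisyBoundary .Z ≤ 10 := by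
    intro k l l' h hl h01 h34
    obtain ⟨⟨_, H, L⟩, hx, rfl⟩ := exists_mem_pairErrors l l' hl h01 h34
    obtain ⟨hL, hcard⟩ := flipsZLogical_of_mem_pairErrors _ hx
    refine (basisDistance_le_of_isHook hS hU hm noisyBoundary h h (H := H) (H₁ := []) (L := L)
      (by simpa [portPairs] using hL)).trans ?_
    exact_mod_cast hcard
  by_cases h01 : (l, l') = (0, 1)
  · by_cases h34 : (l₁, l₁') = (3, 4)
    · cases h01
      cases h34
      exact basisDistance_le_of_isHook hS hU hm noisyBoundary h h₁
        flipsZLogical_portPairs_zero_one_three_four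
    -- The second pair is not `(0, 1)` too, since the smaller ports of the two pairs differ.
    · refine hpair h₁ hl₁ (fun h' => hne ?_) h34
      exact (Prod.mk.inj h01).1.trans (Prod.mk.inj h').1.symm
  by_cases h34 : (l, l') = (3, 4)
  · by_cases h01' : (l₁, l₁') = (0, 1)
    · cases h34
      cases h01'
      exact basisDistance_le_of_isHook hS hU hm noisyBoundary h₁ h
        flipsZLogical_portPairs_zero_one_three_four
    · refine hpair h₁ hl₁ h01' (fun h' => hne ?_)
      exact (Prod.mk.inj h34).1.trans (Prod.mk.inj h').1.symm
  exact hpair h hl h01 h34
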